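/- Let $\mathbb H=\{z\in\mathbb C:\operatorname{Im} z>0\}$ and let $f:\mathbb H\to\mathbb H$ be holomorphic and hyperbolic with Denjoy--Wolff point infinity, that is, $f$ has no fixed point in $\mathbb H$, its iterates $f^n$ converge to $\infty$ locally uniformly on $\mathbb H$, and the angular derivative $f'(\infty)=\angle\lim_{z\to\infty} f(z)/z$ exists and is a real number larger than $1$. Let $f$ be represented by the triplet $(\alpha,\beta,\mu)$, where $\alpha\ge 0$, $\beta\in\mathbb R$ and $\mu$ is a positive finite Borel measure on $\mathbb R$: $$f(z)=\alpha z+\beta+\int_{\mathbb R}\frac{1+tz}{t-z}\,d\mu(t),\qquad z\in\mathbb H,$$ and suppose that $\mu\neq 0$. For $n\ge 1$ put $$I_n=\int_{\mathbb R}\frac{1+t^2}{t^2}\log\left(\frac{\alpha^{2n}(t^2+1)}{t^2+\alpha^{2n}}\right)d\mu(t),$$ where the integrand is extended continuously to $t=0$ by the value $(\alpha^{2n}-1)/\alpha^{2n}$. Then for each $z\in\mathbb H$ there are positive constants $C_1=C_1(z)$ and $C_2=C_2(z)$ such that $$C_1\le \frac{1}{I_n}\log\left(\frac{|f^{n+1}(z)|}{\alpha^{n+1}\operatorname{Im}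 z}\right)\le C_2\qquad\text{for all integers } n\ge 1 .$$ Moreover, for a given $z\in\mathbb H$, there are positive constants $C_1,C_2$ with $$C_1\le \frac{1}{I_n}\log\left(\frac{|f^{n+1}(z)|}{\alpha^{n+1}}\right)\le C_2\qquad\text{for all integers } n\ge 1$$ if and only if $\inf_{n\ge 1}|f^{n+1}(z)|/\alpha^{n+1}>1$. -/

import Mathlib

open Filter Topology MeasureTheory

noncomputable section

namespace HalfPlaneDynamics

/-- `f(z) / z → a` as `z → ∞` non-tangentially, i.e. inside every sector
`{|Re z| ≤ M Im z}` of the upper half-plane: the angular derivative of `f` at infinity is `a`. -/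
def HasAngularDerivAtInfty (f : UpperHalfPlane → UpperHalfPlane) (a : ℝ) : Prop :=
  ∀ M : ℝ, 0 < M →
    Tendsto (fun z : UpperHalfPlane => (f z : ℂ) / (z : ℂ))
      (comap (fun z : UpperHalfPlane => ‖(z : ℂ)‖) atTop ⊓
        𝓟 {z : UpperHalfPlane | |z.re| ≤ M * z.im})
      (𝓝 (a : ℂ))

/-- A non-elliptic holomorphic self-map of the upper half-plane whose Denjoy--Wolff point is
infinity: `f` has no fixed point and its iterates converge to infinity locally uniformly. -/
structure IsNonellipticAtInfty (f : UpperHalfPlane → UpperHalfPlane) : Prop where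
  holomorphic : MDifferentiable (modelWithCornersSelf ℂ ℂ) (modelWithCornersSelf ℂ ℂ) f
  no_fixed_point : ∀ z, f z ≠ z
  iterates_tendsto_infty : ∀ K : Set UpperHalfPlane, IsCompact K → ∀ R : ℝ,
    ∀ᶠ n : ℕ in atTop, ∀ z ∈ K, R ≤ ‖((f^[n] z : UpperHalfPlane) : ℂ)‖

/-- A hyperbolic self-map with Denjoy--Wolff point infinity: its angular derivative at infinity
is larger than one. -/
structure IsHyperbolicAtInfty (f : UpperHalfPlane → UpperHalfPlane) : Prop extends
    IsNonellipticAtInfty f where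
  one_lt_angularDeriv : ∃ a : ℝ, 1 < a ∧ HasAngularDerivAtInfty f a

/-- `f` is represented by the Herglotz triplet `(α, β, μ)`. For a finite measure `μ` the
integrand is bounded and continuous in `t`, hence integrable. -/
structure IsRepresentedBy (f : UpperHalfPlane → UpperHalfPlane) (α β : ℝ) (μ : Measure ℝ) :
    Prop where
  nonneg : 0 ≤ α
  eq : ∀ z : UpperHalfPlane, (f z : ℂ) = (α : ℂ) * (z : ℂ) + (β : ℂ) +
    ∫ t : ℝ, (1 + (t : ℂ) * (z : ℂ)) / ((t : ℂ) - (z : ℂ)) ∂μ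

/-- The function `(1 + t²) / t² * log (α^(2n) (t² + 1) / (t² + α^(2n)))`, with its limit value
`(α^(2n) - 1) / α^(2n)` at `t = 0` (so that it is continuous in `t`). -/
def divergenceIntegrand (α : ℝ) (n : ℕ) (t : ℝ) : ℝ :=
  if t = 0 then (α ^ (2 * n) - 1) / α ^ (2 * n)
  else (1 + t ^ 2) / t ^ 2 *
    Real.log (α ^ (2 * n) * (t ^ 2 + 1) / (t ^ 2 + α ^ (2 * n)))

/-- The integral of `divergenceIntegrand` (a bounded continuous function) against `μ`. -/
def divergenceIntegral (α : ℝ) (μ : Measure ℝ) (n : ℕ) : ℝ :=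
  ∫ t : ℝ, divergenceIntegrand α n t ∂μ

end HalfPlaneDynamics

end

open Filter Topology MeasureTheory

namespace HalfPlaneDynamics

/-! The factor by which `f` multiplies imaginary parts is `α` plus a Poisson integral of `μ`, and
`α` is the angular derivative (`angularDeriv_eq`), so `α > 1`. Hence `log (Im fⁿ(z) / (αⁿ Im z))` is
exactly a sum of logarithms of these factors over `α` (`log_im_iterate`). Schwarz–Pick bounds the
hyperbolic steps. With the geometric growth of imaginary parts this keeps the orbit in a sector
(`exists_sector`), so the modulus is comparable to the imaginary part and each factor is bounded.
The `k`-th logarithm is then comparable to the Poisson integral at `fᵏ(z)`. Both sides of the claim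
are compared with partial sums of the decreasing sequence `radialMass`, the Poisson integrals at `i
αᵏ`: orbits in `exists_log_norm_bounds`, `I_n` in `divergenceIntegral_bounds` by telescoping its
logarithm. Since `μ ≠ 0`, these sums are bounded below by a positive constant, which absorbs
additive errors. Removing `Im z` from the quotient adds the constant `log (Im z)`, which is harmless
exactly when the new logarithm stays away from zero. -/

/-! ### Poisson and Herglotz kernels. -/

/-- The Poisson-type kernel `(1 + t²) / |t - z|²`, with `z = x + iy`. -/
noncomputable def poissonKernel (z : ℂ) (t : ℝ) : ℝ := (1 + t ^ 2) / ((t - z.re) ^ 2 + z.im ^ 2)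

/-- The integrand of the Herglotz representation. -/
noncomputable def herglotzKernel (z : ℂ) (t : ℝ) : ℂ := (1 + (t : ℂ) * z) / ((t : ℂ) - z)

lemma poissonKernel_denom_pos {z : ℂ} (hz : 0 < z.im) (t : ℝ) :
    0 < (t - z.re) ^ 2 + z.im ^ 2 := by positivity

lemma poissonKernel_pos {z : ℂ} (hz : 0 < z.im) (t : ℝ) : 0 < poissonKernel z t :=
  div_pos (by positivity) (poissonKernel_denom_pos hz t)

lemma ofReal_sub_ne_zero {z : ℂ} (hz : 0 < z.im) (t : ℝ) : (t : ℂ) - z ≠ 0 := by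
  intro h
  have := congrArg Complex.im h
  simp at this
  linarith

lemma sq_norm_ofReal_sub (z : ℂ) (t : ℝ) :
    ‖(t : ℂ) - z‖ ^ 2 = (t - z.re) ^ 2 + z.im ^ 2 := by
  rw [← Complex.normSq_eq_norm_sq, Complex.normSq_apply]
  simp
  ring

lemma continuous_poissonKernel {z : ℂ} (hz : 0 < z.im) : Continuous (poissonKernel z) := by
  unfold poissonKernel
  exact Continuous.div (by fun_prop) (by fun_prop) fun t => (poissonKernel_denom_pos hz t).ne'

lemma continuous_herglotzKernel {z : ℂ} (hz : 0 < z.im) : Continuous (herglotzKernel z) := by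
  unfold herglotzKernel
  exact Continuous.div (by fun_prop) (by fun_prop) fun t => ofReal_sub_ne_zero hz t

lemma poissonKernel_le {z : ℂ} (hz : 0 < z.im) (t : ℝ) :
    poissonKernel z t ≤ 2 + (1 + 2 * z.re ^ 2) / z.im ^ 2 := by
  unfold poissonKernel
  rw [div_le_iff₀ (poissonKernel_denom_pos hz t)]
  have h1 : (1 + 2 * z.re ^ 2) ≤
      (1 + 2 * z.re ^ 2) / z.im ^ 2 * ((t - z.re) ^ 2 + z.im ^ 2) := by
    rw [div_mul_eq_mul_div, le_div_iff₀ (by positivity)]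
    exact mul_le_mul_of_nonneg_left (by nlinarith [sq_nonneg (t - z.re)]) (by positivity)
  nlinarith [sq_nonneg (t - 2 * z.re), sq_nonneg z.im]

lemma herglotzKernel_eq {z : ℂ} (hz : 0 < z.im) (t : ℝ) :
    herglotzKernel z t = z + (1 + z ^ 2) / ((t : ℂ) - z) := by
  have := ofReal_sub_ne_zero hz t
  unfold herglotzKernel
  field_simp
  ring

lemma norm_herglotzKernel_le {z : ℂ} (hz : 0 < z.im) (t : ℝ) :
    ‖herglotzKernel z t‖ ≤ ‖z‖ + ‖1 + z ^ 2‖ / z.im := by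
  rw [herglotzKernel_eq hz]
  refine (norm_add_le _ _).trans ?_
  rw [norm_div]
  gcongr
  have := Complex.abs_im_le_norm ((t : ℂ) - z)
  simp only [Complex.sub_im, Complex.ofReal_im, zero_sub, abs_neg, abs_of_pos hz] at this
  exact this

lemma integrable_poissonKernel (μ : Measure ℝ) [IsFiniteMeasure μ] {z : ℂ} (hz : 0 < z.im) :
    Integrable (poissonKernel z) μ :=
  Integrable.of_bound (continuous_poissonKernel hz).aestronglyMeasurable _
    (Eventually.of_forall fun t => by
      rw [Real.norm_of_nonneg (poissonKernel_pos hz t).le]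
      exact poissonKernel_le hz t)

lemma integrable_herglotzKernel (μ : Measure ℝ) [IsFiniteMeasure μ] {z : ℂ} (hz : 0 < z.im) :
    Integrable (herglotzKernel z) μ :=
  Integrable.of_bound (continuous_herglotzKernel hz).aestronglyMeasurable _
    (Eventually.of_forall fun t => norm_herglotzKernel_le hz t)

lemma im_herglotzKernel (z : ℂ) (t : ℝ) :
    (herglotzKernel z t).im = z.im * poissonKernel z t := by
  unfold herglotzKernel poissonKernel
  rw [Complex.div_im, Complex.normSq_eq_norm_sq, sq_norm_ofReal_sub]
  simp
  ring

/-- The difference factors as `(z - w)(1 + t²) / ((t - z)(t - w))`, and weighted AM–GM splits the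
denominator. Leaving `c` free until after integration replaces Cauchy–Schwarz. -/
lemma norm_herglotzKernel_sub {z w : ℂ} (hz : 0 < z.im) (hw : 0 < w.im) (t : ℝ) {c : ℝ}
    (hc : 0 < c) :
    ‖herglotzKernel z t - herglotzKernel w t‖ ≤
      ‖z - w‖ * ((c * poissonKernel z t + c⁻¹ * poissonKernel w t) / 2) := by
  have h1 := ofReal_sub_ne_zero hz t
  have h2 := ofReal_sub_ne_zero hw t
  have e : herglotzKernel z t - herglotzKernel w t =
      (z - w) * ((1 + (t : ℂ) ^ 2) / (((t : ℂ) - z) * ((t : ℂ) - w))) := by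
    unfold herglotzKernel
    field_simp
    ring
  rw [e, norm_mul]
  refine mul_le_mul_of_nonneg_left ?_ (norm_nonneg _)
  have n1 : ‖(1 + (t : ℂ) ^ 2)‖ = 1 + t ^ 2 := by
    rw [show (1 + (t : ℂ) ^ 2) = ((1 + t ^ 2 : ℝ) : ℂ) by push_cast; ring, Complex.norm_real,
      Real.norm_of_nonneg (by positivity)]
  rw [norm_div, norm_mul, n1]
  unfold poissonKernel
  rw [← sq_norm_ofReal_sub, ← sq_norm_ofReal_sub]
  have p1 := norm_pos_iff.mpr h1
  have p2 := norm_pos_iff.mpr h2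
  generalize ‖(t : ℂ) - z‖ = a at *
  generalize ‖(t : ℂ) - w‖ = b at *
  have key : 1 / (a * b) ≤ (c * (1 / a ^ 2) + c⁻¹ * (1 / b ^ 2)) / 2 := by
    have : (c * (1 / a ^ 2) + c⁻¹ * (1 / b ^ 2)) / 2 - 1 / (a * b) =
        (c * b - a) ^ 2 / (2 * c * a ^ 2 * b ^ 2) := by
      field_simp
      ring
    have h : 0 ≤ (c * b - a) ^ 2 / (2 * c * a ^ 2 * b ^ 2) := by positivity
    linarith
  have := mul_le_mul_of_nonneg_left key (show 0 ≤ 1 + t ^ 2 by positivity)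
  calc _ = (1 + t ^ 2) * (1 / (a * b)) := by ring
    _ ≤ _ := this
    _ = _ := by ring

/-- The factor by which a map with Herglotz triplet `(α, β, μ)` multiplies the imaginary part. -/
noncomputable def imFactor (α : ℝ) (μ : Measure ℝ) (z : ℂ) : ℝ := α + ∫ t, poissonKernel z t ∂μ

/-! ### Imaginary parts, Schwarz–Pick and the angular derivative. -/

section Map

variable {f : UpperHalfPlane → UpperHalfPlane} {α β : ℝ} {μ : Measure ℝ}

lemma IsRepresentedBy.coe_eq (hrep : IsRepresentedBy f α β μ) (z : UpperHalfPlane) :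
    (f z : ℂ) = α * z + β + ∫ t, herglotzKernel z t ∂μ := hrep.eq z

variable [IsFiniteMeasure μ]

lemma IsRepresentedBy.im_eq (hrep : IsRepresentedBy f α β μ) (z : UpperHalfPlane) :
    (f z).im = z.im * imFactor α μ z := by
  have h := congrArg Complex.im (hrep.coe_eq z)
  have e : (∫ t, herglotzKernel z t ∂μ).im = ∫ t, (herglotzKernel z t).im ∂μ :=
    (integral_im (𝕜 := ℂ) (integrable_herglotzKernel μ z.im_pos)).symm
  simp only [Complex.add_im, Complex.mul_im, Complex.ofReal_re, Complex.ofReal_im, zero_mul,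
    add_zero, e, im_herglotzKernel, integral_const_mul] at h
  unfold imFactor
  simp only [UpperHalfPlane.coe_im] at h
  rw [h]
  ring

lemma integral_poissonKernel_nonneg (μ : Measure ℝ) {z : ℂ} (hz : 0 < z.im) :
    0 ≤ ∫ t, poissonKernel z t ∂μ :=
  integral_nonneg fun t => (poissonKernel_pos hz t).le

lemma le_imFactor (α : ℝ) (μ : Measure ℝ) {z : ℂ} (hz : 0 < z.im) : α ≤ imFactor α μ z :=
  le_add_of_nonneg_right (integral_poissonKernel_nonneg μ hz)

lemma IsRepresentedBy.norm_sub_le (hrep : IsRepresentedBy f α β μ) (z w : UpperHalfPlane) {c : ℝ}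
    (hc : 0 < c) : ‖(f z : ℂ) - f w‖ ≤
      ‖(z : ℂ) - w‖ * ((c * imFactor α μ z + c⁻¹ * imFactor α μ w) / 2) := by
  have iz := integrable_poissonKernel μ z.im_pos
  have iw := integrable_poissonKernel μ w.im_pos
  have e : (f z : ℂ) - f w = α * ((z : ℂ) - w) +
      ∫ t, (herglotzKernel z t - herglotzKernel w t) ∂μ := by
    rw [hrep.coe_eq z, hrep.coe_eq w, integral_sub (integrable_herglotzKernel μ z.im_pos)
      (integrable_herglotzKernel μ w.im_pos)]
    ring
  have hint : ‖∫ t, (herglotzKernel z t - herglotzKernel w t) ∂μ‖ ≤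
      ‖(z : ℂ) - w‖ * ((c * (∫ t, poissonKernel z t ∂μ) + c⁻¹ * ∫ t, poissonKernel w t ∂μ) / 2) := by
    refine (norm_integral_le_of_norm_le (((iz.const_mul c).add (iw.const_mul c⁻¹)).div_const 2
      |>.const_mul ‖(z : ℂ) - w‖) (Eventually.of_forall fun t =>
        norm_herglotzKernel_sub z.im_pos w.im_pos t hc)).trans_eq ?_
    rw [integral_const_mul, integral_div]
    congr 2
    exact (integral_add (iz.const_mul c) (iw.const_mul c⁻¹)).trans (by
      rw [integral_const_mul, integral_const_mul])
  have hα : ‖(α : ℂ) * ((z : ℂ) - w)‖ ≤ ‖(z : ℂ) - w‖ * ((c * α + c⁻¹ * α) / 2) := by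
    rw [norm_mul, Complex.norm_real, Real.norm_of_nonneg hrep.nonneg, mul_comm]
    refine mul_le_mul_of_nonneg_left ?_ (norm_nonneg _)
    have : 2 ≤ c + c⁻¹ := by
      have : c + c⁻¹ - 2 = (c - 1) ^ 2 / c := by field_simp; ring
      have : 0 ≤ (c - 1) ^ 2 / c := by positivity
      linarith
    nlinarith [hrep.nonneg]
  rw [e]
  refine (norm_add_le _ _).trans ((add_le_add hα hint).trans_eq ?_)
  unfold imFactor
  ring

/-- The Schwarz--Pick inequality, read off from the Herglotz representation. -/
lemma IsRepresentedBy.sq_norm_sub_le (hrep : IsRepresentedBy f α β μ) (hα : 0 < α)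
    (z w : UpperHalfPlane) : ‖(f z : ℂ) - f w‖ ^ 2 ≤
      ‖(z : ℂ) - w‖ ^ 2 * (imFactor α μ z * imFactor α μ w) := by
  have pz : 0 < imFactor α μ z := hα.trans_le (le_imFactor α μ z.im_pos)
  have pw : 0 < imFactor α μ w := hα.trans_le (le_imFactor α μ w.im_pos)
  -- This weight makes the two terms of the mean equal, turning it into a geometric mean.
  have h := hrep.norm_sub_le z w (c := √(imFactor α μ w) / √(imFactor α μ z)) (by positivity)
  obtain ⟨a, ha⟩ : ∃ a, a = √(imFactor α μ z) := ⟨_, rfl⟩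
  obtain ⟨b, hb⟩ : ∃ b, b = √(imFactor α μ w) := ⟨_, rfl⟩
  have ha2 : imFactor α μ z = a ^ 2 := by rw [ha, Real.sq_sqrt pz.le]
  have hb2 : imFactor α μ w = b ^ 2 := by rw [hb, Real.sq_sqrt pw.le]
  have pa : 0 < a := ha ▸ Real.sqrt_pos.mpr pz
  have pb : 0 < b := hb ▸ Real.sqrt_pos.mpr pw
  rw [← ha, ← hb, ha2, hb2] at h
  rw [ha2, hb2]
  have e : (b / a * a ^ 2 + (b / a)⁻¹ * b ^ 2) / 2 = a * b := by
    field_simp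
    ring
  rw [e] at h
  calc _ ≤ (‖(z : ℂ) - w‖ * (a * b)) ^ 2 := pow_le_pow_left₀ (norm_nonneg _) h 2
    _ = _ := by ring

/-- Along the points `i(n + 1)` the real part of `f(w) / w` is the factor `imFactor`, whose Poisson
integral vanishes in the limit by dominated convergence. The shift by one keeps the height at least
`1`, so the kernel is bounded by `1`. -/
lemma IsRepresentedBy.angularDeriv_eq (hrep : IsRepresentedBy f α β μ) {a : ℝ}
    (ha : HasAngularDerivAtInfty f a) : a = α := by
  let w : ℕ → UpperHalfPlane := fun n => ⟨((n : ℝ) + 1 : ℝ) * Complex.I, by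
    simp
    positivity⟩
  have wc : ∀ n, (w n : ℂ) = ((n : ℝ) + 1 : ℝ) * Complex.I := fun n => rfl
  have wim : ∀ n, (w n).im = (n : ℝ) + 1 := fun n => by
    rw [← UpperHalfPlane.coe_im, wc]; simp
  have wre : ∀ n, (w n).re = 0 := fun n => by
    rw [← UpperHalfPlane.coe_re, wc]; simp
  have hn : Tendsto (fun n : ℕ => (n : ℝ) + 1) atTop atTop :=
    tendsto_atTop_add_const_right _ _ tendsto_natCast_atTop_atTop
  have h1 : Tendsto w atTop (comap (fun z : UpperHalfPlane => ‖(z : ℂ)‖) atTop ⊓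
        𝓟 {z : UpperHalfPlane | |z.re| ≤ 1 * z.im}) := by
    refine tendsto_inf.mpr ⟨tendsto_comap_iff.mpr ?_, tendsto_principal.mpr ?_⟩
    · refine hn.congr fun n => ?_
      simp only [Function.comp, wc, norm_mul, Complex.norm_I, mul_one, Complex.norm_real]
      rw [Real.norm_of_nonneg (by positivity)]
    · refine Eventually.of_forall fun n => ?_
      simp only [Set.mem_ofPred_eq, wre, wim, abs_zero]
      positivity
  have h2 := (Complex.continuous_re.tendsto _).comp ((ha 1 one_pos).comp h1)
  have h3 : ∀ n, ((f (w n) : ℂ) / (w n : ℂ)).re = imFactor α μ (w n) := fun n => by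
    have p : ((n : ℝ) + 1) ≠ 0 := by positivity
    have him := hrep.im_eq (w n)
    rw [wim, ← UpperHalfPlane.coe_im] at him
    have e : (f (w n) : ℂ) / (w n : ℂ) = (-Complex.I * f (w n)) / ((n : ℝ) + 1 : ℝ) := by
      rw [wc]
      have : (((n : ℝ) + 1 : ℝ) : ℂ) ≠ 0 := by exact_mod_cast p
      field_simp
      linear_combination (f (w n) : ℂ) * Complex.I_sq
    rw [e, Complex.div_ofReal_re]
    simp only [Complex.mul_re, Complex.neg_re, Complex.I_re, Complex.neg_im, Complex.I_im]
    rw [him]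
    field_simp
    ring
  have h4 : Tendsto (fun n => imFactor α μ (w n)) atTop (𝓝 (α + ∫ _ : ℝ, (0 : ℝ) ∂μ)) := by
    refine tendsto_const_nhds.add ?_
    refine tendsto_integral_of_dominated_convergence (fun _ => 1)
      (fun n => (continuous_poissonKernel (w n).im_pos).aestronglyMeasurable)
      (integrable_const 1) (fun n => Eventually.of_forall fun t => ?_)
      (Eventually.of_forall fun t => ?_)
    · rw [Real.norm_of_nonneg (poissonKernel_pos (w n).im_pos t).le]
      unfold poissonKernel
      rw [div_le_one (poissonKernel_denom_pos (w n).im_pos t)]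
      rw [UpperHalfPlane.coe_im, UpperHalfPlane.coe_re, wim, wre]
      have : (0 : ℝ) ≤ n := by positivity
      nlinarith
    · unfold poissonKernel
      simp only [UpperHalfPlane.coe_im, UpperHalfPlane.coe_re, wim, wre]
      refine Tendsto.div_atTop tendsto_const_nhds ?_
      exact tendsto_atTop_add_const_left _ _ ((tendsto_pow_atTop two_ne_zero).comp hn)
  simp only [integral_zero, add_zero] at h4
  have h5 := tendsto_nhds_unique (h2.congr h3) h4
  simpa using h5

end Map

/-! ### Hyperbolic steps, sectors and growth along an orbit. -/

section Orbit

variable {f : UpperHalfPlane → UpperHalfPlane} {α β : ℝ} {μ : Measure ℝ} [IsFiniteMeasure μ]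

lemma IsRepresentedBy.im_iterate_succ (hrep : IsRepresentedBy f α β μ) (z : UpperHalfPlane)
    (n : ℕ) : (f^[n + 1] z).im = (f^[n] z).im * imFactor α μ (f^[n] z) := by
  rw [Function.iterate_succ_apply', hrep.im_eq]

lemma IsRepresentedBy.mul_im_iterate_le (hrep : IsRepresentedBy f α β μ) (z : UpperHalfPlane)
    (n : ℕ) : α * (f^[n] z).im ≤ (f^[n + 1] z).im := by
  rw [hrep.im_iterate_succ, mul_comm]
  exact mul_le_mul_of_nonneg_left (le_imFactor α μ (f^[n] z).im_pos) (f^[n] z).im_pos.le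

lemma IsRepresentedBy.pow_mul_im_le (hrep : IsRepresentedBy f α β μ) (z : UpperHalfPlane)
    (n : ℕ) : α ^ n * z.im ≤ (f^[n] z).im := by
  induction n with
  | zero => simp
  | succ n ih =>
    refine le_trans ?_ (hrep.mul_im_iterate_le z n)
    rw [pow_succ', mul_assoc]
    exact mul_le_mul_of_nonneg_left ih hrep.nonneg

/-- The hyperbolic steps of an orbit are bounded. -/
lemma IsRepresentedBy.exists_step_bound (hrep : IsRepresentedBy f α β μ) (hα : 0 < α)
    (z : UpperHalfPlane) : ∃ D : ℝ, 0 ≤ D ∧ ∀ n : ℕ,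
      ‖(f^[n + 1] z : ℂ) - f^[n] z‖ ^ 2 ≤ D * ((f^[n + 1] z).im * (f^[n] z).im) := by
  have p0 := z.im_pos
  have p1 := (f z).im_pos
  -- The constant is the ratio for the first step; Schwarz–Pick makes this ratio nonincreasing along
  -- the orbit.
  refine ⟨‖(f z : ℂ) - z‖ ^ 2 / ((f z).im * z.im), by positivity, fun n => ?_⟩
  induction n with
  | zero =>
    simp only [zero_add, Function.iterate_one, Function.iterate_zero, id]
    rw [div_mul_cancel₀ _ (by positivity)]
  | succ n ih =>
    have h := hrep.sq_norm_sub_le hα (f^[n + 1] z) (f^[n] z)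
    rw [← Function.iterate_succ_apply' f, ← Function.iterate_succ_apply' f] at h
    have a1 := hα.trans_le (le_imFactor α μ (f^[n + 1] z).im_pos)
    have a2 := hα.trans_le (le_imFactor α μ (f^[n] z).im_pos)
    rw [hrep.im_iterate_succ z (n + 1)]
    refine h.trans ((mul_le_mul_of_nonneg_right ih (mul_pos a1 a2).le).trans_eq ?_)
    rw [hrep.im_iterate_succ z n]
    ring

/-- Orbits of a hyperbolic map stay in a sector, and their imaginary parts grow at most
geometrically. -/
lemma IsRepresentedBy.exists_sector (hrep : IsRepresentedBy f α β μ) (hα : 1 < α)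
    (z : UpperHalfPlane) : ∃ M K : ℝ, 0 ≤ M ∧ 1 ≤ K ∧ ∀ n : ℕ,
      |(f^[n] z).re| ≤ M * (f^[n] z).im ∧ (f^[n + 1] z).im ≤ K * (f^[n] z).im := by
  obtain ⟨D, hD, h⟩ := hrep.exists_step_bound (one_pos.trans hα) z
  have hstep : ∀ n : ℕ, (f^[n + 1] z).im ≤ (D + 2) * (f^[n] z).im ∧
      |(f^[n + 1] z).re - (f^[n] z).re| ≤ (D + 2) * (f^[n] z).im := fun n => by
    have hn := h n
    have hm := hrep.mul_im_iterate_le z n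
    have q0 := (f^[n] z).im_pos
    have q1 := (f^[n + 1] z).im_pos
    rw [← Complex.normSq_eq_norm_sq, Complex.normSq_apply] at hn
    simp only [Complex.sub_re, Complex.sub_im, UpperHalfPlane.coe_re, UpperHalfPlane.coe_im] at hn
    generalize (f^[n + 1] z).im = v at *
    generalize (f^[n] z).im = u at *
    generalize (f^[n + 1] z).re - (f^[n] z).re = x at *
    -- Expanding `(v - u)² + x² ≤ D v u` gives `v² ≤ (D + 2) u v`; then `v` cancels.
    have hv : v ≤ (D + 2) * u := by
      refine le_of_mul_le_mul_right ?_ q1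
      nlinarith [mul_self_nonneg x, sq_nonneg u]
    refine ⟨hv, abs_le_of_sq_le_sq ?_ (by positivity)⟩
    have : D * (v * u) ≤ D * ((D + 2) * u * u) := by gcongr
    nlinarith [mul_self_nonneg (v - u), mul_pos q0 q0, mul_nonneg hD (mul_pos q0 q0).le]
  have hα' : 0 < α - 1 := by linarith
  -- The first term of `M` covers `n = 0`. The second gives `D + 2 ≤ M (α - 1)`, so a horizontal
  -- step is paid for by the growth of the height: `M u + (D + 2) u ≤ M α u`.
  refine ⟨|z.re| / z.im + (D + 2) / (α - 1), D + 2, ?_, by linarith, fun n => ⟨?_, (hstep n).1⟩⟩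
  · have := z.im_pos
    positivity
  · induction n with
    | zero =>
      simp only [Function.iterate_zero, id]
      rw [add_mul, div_mul_cancel₀ _ z.im_ne_zero]
      have := z.im_pos
      have : 0 ≤ (D + 2) / (α - 1) * z.im := by positivity
      linarith
    | succ n ih =>
      have hx := (hstep n).2
      have hm := hrep.mul_im_iterate_le z n
      have q0 := (f^[n] z).im_pos
      have hM : D + 2 ≤ (|z.re| / z.im + (D + 2) / (α - 1)) * (α - 1) := by
        rw [add_mul, div_mul_cancel₀ _ hα'.ne']
        have := z.im_pos
        have : 0 ≤ |z.re| / z.im * (α - 1) := by positivity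
        linarith
      have hM0 : 0 ≤ |z.re| / z.im + (D + 2) / (α - 1) := by
        have := z.im_pos
        positivity
      generalize |z.re| / z.im + (D + 2) / (α - 1) = M at *
      have tri : |(f^[n + 1] z).re| ≤ |(f^[n + 1] z).re - (f^[n] z).re| + |(f^[n] z).re| := by
        simpa using abs_add_le ((f^[n + 1] z).re - (f^[n] z).re) (f^[n] z).re
      have e1 := mul_le_mul_of_nonneg_right hM q0.le
      have e2 := mul_le_mul_of_nonneg_left hm hM0
      linarith

lemma IsRepresentedBy.log_im_iterate (hrep : IsRepresentedBy f α β μ) (hα : 0 < α)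
    (z : UpperHalfPlane) (n : ℕ) : Real.log ((f^[n] z).im / (α ^ n * z.im)) =
      ∑ k ∈ Finset.range n, Real.log (imFactor α μ (f^[k] z) / α) := by
  induction n with
  | zero => simp [z.im_ne_zero]
  | succ n ih =>
    have q0 := (f^[n] z).im_pos
    have q := z.im_pos
    have a2 := hα.trans_le (le_imFactor α μ (f^[n] z).im_pos)
    rw [Finset.sum_range_succ, ← ih, ← Real.log_mul (by positivity) (by positivity),
      hrep.im_iterate_succ]
    congr 1
    field_simp
    ring

end Orbit

/-! ### Comparison of the divergence integral and Poisson kernels with radial masses. -/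

section Comparison

/-- The mass `∫ (1 + t²) / (t² + α^(2k)) dμ`. -/
noncomputable def radialMass (α : ℝ) (μ : Measure ℝ) (k : ℕ) : ℝ :=
  ∫ t, (1 + t ^ 2) / (t ^ 2 + α ^ (2 * k)) ∂μ

variable {α : ℝ}

lemma integrable_radial (hα : 0 < α) (μ : Measure ℝ) [IsFiniteMeasure μ] (k : ℕ) :
    Integrable (fun t : ℝ => (1 + t ^ 2) / (t ^ 2 + α ^ (2 * k))) μ := by
  -- The radial integrand is the Poisson kernel at `i αᵏ`.
  have := integrable_poissonKernel μ (z := ((α ^ k : ℝ) : ℂ) * Complex.I)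
    (by simp only [Complex.mul_im, Complex.ofReal_re, Complex.I_im, Complex.ofReal_im,
          Complex.I_re, mul_zero, mul_one, add_zero]
        positivity)
  refine this.congr (Eventually.of_forall fun t => ?_)
  simp only [poissonKernel, Complex.mul_im, Complex.mul_re, Complex.ofReal_re, Complex.I_im,
    Complex.ofReal_im, Complex.I_re, mul_zero, mul_one, add_zero, sub_zero]
  rw [← pow_mul, mul_comm k 2]

lemma radialMass_nonneg (hα : 0 < α) (μ : Measure ℝ) (k : ℕ) : 0 ≤ radialMass α μ k :=
  integral_nonneg fun t => by
    simp only [Pi.zero_apply]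
    positivity

lemma radialMass_zero (α : ℝ) (μ : Measure ℝ) : radialMass α μ 0 = μ.real Set.univ := by
  have : ∀ t : ℝ, (1 + t ^ 2) / (t ^ 2 + α ^ (2 * 0)) = 1 := fun t => by
    have : 0 < 1 + t ^ 2 := by positivity
    rw [mul_zero, pow_zero, add_comm (t ^ 2), div_self this.ne']
  simp only [radialMass, this, integral_const, smul_eq_mul, mul_one]

lemma radialMass_zero_pos (α : ℝ) {μ : Measure ℝ} [IsFiniteMeasure μ] (hμ : μ ≠ 0) :
    0 < radialMass α μ 0 := by
  rw [radialMass_zero]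
  have : NeZero μ := ⟨hμ⟩
  exact measureReal_univ_pos

lemma radialMass_antitone (hα : 1 < α) (μ : Measure ℝ) [IsFiniteMeasure μ] :
    Antitone (radialMass α μ) := fun j k hjk => by
  have h0 : 0 < α := one_pos.trans hα
  refine integral_mono (integrable_radial h0 μ k) (integrable_radial h0 μ j) fun t => ?_
  have : α ^ (2 * j) ≤ α ^ (2 * k) := pow_le_pow_right₀ hα.le (by omega)
  dsimp only
  gcongr

lemma log_telescope (hα : 0 < α) (n : ℕ) (t : ℝ) :
    Real.log (α ^ (2 * n) * (t ^ 2 + 1) / (t ^ 2 + α ^ (2 * n))) =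
      ∑ k ∈ Finset.range n,
        Real.log (α ^ 2 * (t ^ 2 + α ^ (2 * k)) / (t ^ 2 + α ^ (2 * (k + 1)))) := by
  induction n with
  | zero =>
    have : 0 < t ^ 2 + 1 := by positivity
    simp [this.ne']
  | succ n ih =>
    rw [Finset.sum_range_succ, ← ih, ← Real.log_mul (by positivity) (by positivity)]
    congr 1
    have : α ^ (2 * (n + 1)) = α ^ 2 * α ^ (2 * n) := by ring
    rw [this]
    field_simp

/-- Apply `1 - 1/r ≤ log r ≤ r - 1` to each telescoped factor `r`. Both outer terms carry a factor
`t²`, which cancels the singular prefactor. At `t = 0` the lower bound is an equality, a geometric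
sum. -/
lemma divergenceIntegrand_bounds (hα : 1 < α) (n : ℕ) (t : ℝ) :
    (α ^ 2 - 1) / α ^ 2 * ∑ k ∈ Finset.range n, (1 + t ^ 2) / (t ^ 2 + α ^ (2 * k)) ≤
        divergenceIntegrand α n t ∧
      divergenceIntegrand α n t ≤
        (α ^ 2 - 1) * ∑ k ∈ Finset.range n, (1 + t ^ 2) / (t ^ 2 + α ^ (2 * k)) := by
  have h0 : 0 < α := one_pos.trans hα
  have h1 : 0 < α ^ 2 - 1 := by nlinarith
  have hlog : ∀ k : ℕ, ∀ t : ℝ, t ≠ 0 →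
      (α ^ 2 - 1) / α ^ 2 * ((1 + t ^ 2) / (t ^ 2 + α ^ (2 * k))) ≤ (1 + t ^ 2) / t ^ 2 *
          Real.log (α ^ 2 * (t ^ 2 + α ^ (2 * k)) / (t ^ 2 + α ^ (2 * (k + 1)))) ∧
        (1 + t ^ 2) / t ^ 2 *
          Real.log (α ^ 2 * (t ^ 2 + α ^ (2 * k)) / (t ^ 2 + α ^ (2 * (k + 1)))) ≤
        (α ^ 2 - 1) * ((1 + t ^ 2) / (t ^ 2 + α ^ (2 * k))) := by
    intro k t ht
    have ht2 : 0 < t ^ 2 := by positivity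
    have e : α ^ (2 * (k + 1)) = α ^ 2 * α ^ (2 * k) := by ring
    have hA : 0 < α ^ (2 * k) := by positivity
    rw [e]
    generalize α ^ (2 * k) = A at *
    have hr : 0 < α ^ 2 * (t ^ 2 + A) / (t ^ 2 + α ^ 2 * A) := by positivity
    have l1 := Real.one_sub_inv_le_log_of_pos hr
    have l2 := Real.log_le_sub_one_of_pos hr
    constructor
    · calc _ = (1 + t ^ 2) / t ^ 2 * (1 - (α ^ 2 * (t ^ 2 + A) / (t ^ 2 + α ^ 2 * A))⁻¹) := by
            field_simp
            ring
        _ ≤ _ := by gcongr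
    · calc _ ≤ (1 + t ^ 2) / t ^ 2 * (α ^ 2 * (t ^ 2 + A) / (t ^ 2 + α ^ 2 * A) - 1) := by gcongr
        _ = (α ^ 2 - 1) * ((1 + t ^ 2) / (t ^ 2 + α ^ 2 * A)) := by
            field_simp
            ring
        _ ≤ _ := by
            gcongr
            nlinarith
  unfold divergenceIntegrand
  split_ifs with ht
  · subst ht
    have e : (α ^ (2 * n) - 1) / α ^ (2 * n) =
        (α ^ 2 - 1) / α ^ 2 * ∑ k ∈ Finset.range n, (1 + (0 : ℝ) ^ 2) / (0 ^ 2 + α ^ (2 * k)) := by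
      induction n with
      | zero => simp
      | succ n ih =>
        rw [Finset.sum_range_succ, mul_add ((α ^ 2 - 1) / α ^ 2), ← ih]
        have : α ^ (2 * (n + 1)) = α ^ 2 * α ^ (2 * n) := by ring
        rw [this]
        field_simp
        ring
    refine ⟨e.ge, e.le.trans ?_⟩
    have h2 : (α ^ 2 - 1) / α ^ 2 ≤ α ^ 2 - 1 := div_le_self h1.le (by nlinarith)
    exact mul_le_mul_of_nonneg_right h2 (Finset.sum_nonneg fun k _ => by positivity)
  · rw [log_telescope h0, Finset.mul_sum, Finset.mul_sum, Finset.mul_sum]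
    exact ⟨Finset.sum_le_sum fun k _ => (hlog k t ht).1,
      Finset.sum_le_sum fun k _ => (hlog k t ht).2⟩

lemma measurable_divergenceIntegrand (α : ℝ) (n : ℕ) : Measurable (divergenceIntegrand α n) := by
  unfold divergenceIntegrand
  exact Measurable.ite (measurableSet_singleton 0) measurable_const (by fun_prop)

lemma divergenceIntegral_bounds (hα : 1 < α) (μ : Measure ℝ) [IsFiniteMeasure μ] (n : ℕ) :
    (α ^ 2 - 1) / α ^ 2 * ∑ k ∈ Finset.range n, radialMass α μ k ≤ divergenceIntegral α μ n ∧
      divergenceIntegral α μ n ≤ (α ^ 2 - 1) * ∑ k ∈ Finset.range n, radialMass α μ k := by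
  have h0 : 0 < α := one_pos.trans hα
  have h1 : 0 < α ^ 2 - 1 := by nlinarith
  have hs : Integrable (fun t : ℝ => ∑ k ∈ Finset.range n,
      (1 + t ^ 2) / (t ^ 2 + α ^ (2 * k))) μ :=
    integrable_finsetSum _ fun k _ => integrable_radial h0 μ k
  have hi : Integrable (divergenceIntegrand α n) μ := by
    refine (hs.const_mul (α ^ 2 - 1)).mono'
      (measurable_divergenceIntegrand α n).aestronglyMeasurable (Eventually.of_forall fun t => ?_)
    have hb := divergenceIntegrand_bounds hα n t
    rw [Real.norm_of_nonneg (le_trans (mul_nonneg (by positivity)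
      (Finset.sum_nonneg fun k _ => by positivity)) hb.1)]
    exact hb.2
  have e : ∑ k ∈ Finset.range n, radialMass α μ k =
      ∫ t, ∑ k ∈ Finset.range n, (1 + t ^ 2) / (t ^ 2 + α ^ (2 * k)) ∂μ :=
    (integral_finsetSum _ fun k _ => integrable_radial h0 μ k).symm
  rw [e, ← integral_const_mul, ← integral_const_mul]
  exact ⟨integral_mono (hs.const_mul _) hi fun t => (divergenceIntegrand_bounds hα n t).1,
    integral_mono hi (hs.const_mul _) fun t => (divergenceIntegrand_bounds hα n t).2⟩

/-- Cut `range (m * n)` into blocks of length `m`; the first term of each block dominates the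
others. -/
lemma sum_range_le_mul_sum_of_antitone {J : ℕ → ℝ} (hJ : Antitone J) (h0 : ∀ k, 0 ≤ J k) {m : ℕ}
    (hm : 1 ≤ m) (n : ℕ) :
    ∑ k ∈ Finset.range n, J k ≤ m * ∑ k ∈ Finset.range n, J (m * k) := by
  have h : ∑ k ∈ Finset.range (m * n), J k ≤ m * ∑ k ∈ Finset.range n, J (m * k) := by
    induction n with
    | zero => simp
    | succ n ih =>
      rw [Nat.mul_succ, Finset.sum_range_add, Finset.sum_range_succ, mul_add]
      refine add_le_add ih ?_
      refine (Finset.sum_le_card_nsmul _ _ (J (m * n)) fun j _ => hJ (by omega)).trans_eq ?_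
      simp
  refine le_trans (Finset.sum_le_sum_of_subset_of_nonneg ?_ fun k _ _ => h0 k) h
  exact Finset.range_mono (Nat.le_mul_of_pos_left n hm)

/-- In a sector `(t - x)² + y²` dominates a multiple of `t² + y²`, and a height at least `A c`
allows `y` to be replaced by `A`. -/
lemma poissonKernel_le_radial {z : ℂ} (hz : 0 < z.im) {M A c : ℝ} (hA : 0 < A) (hc : 0 < c)
    (hM : |z.re| ≤ M * z.im) (hAz : A * c ≤ z.im) (t : ℝ) :
    poissonKernel z t ≤
      ((3 + 2 * M ^ 2) * (1 + 1 / c ^ 2)) * ((1 + t ^ 2) / (t ^ 2 + A ^ 2)) := by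
  have hd := poissonKernel_denom_pos hz t
  have hx : z.re ^ 2 ≤ M ^ 2 * z.im ^ 2 := by
    rw [← mul_pow, ← sq_abs]
    exact pow_le_pow_left₀ (abs_nonneg _) hM 2
  have hA2 : A ^ 2 ≤ 1 / c ^ 2 * z.im ^ 2 := by
    rw [one_div, ← div_eq_inv_mul, le_div_iff₀ (by positivity), ← mul_pow]
    exact pow_le_pow_left₀ (by positivity) hAz 2
  have h1 : t ^ 2 + z.im ^ 2 ≤ (3 + 2 * M ^ 2) * ((t - z.re) ^ 2 + z.im ^ 2) := by
    nlinarith [sq_nonneg (t - 2 * z.re), mul_nonneg (sq_nonneg M) (sq_nonneg (t - z.re)),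
      sq_nonneg (t - z.re)]
  have h2 : t ^ 2 + A ^ 2 ≤ (1 + 1 / c ^ 2) * (t ^ 2 + z.im ^ 2) := by
    have : 0 ≤ 1 / c ^ 2 * t ^ 2 := by positivity
    nlinarith [sq_nonneg z.im]
  have h3 : t ^ 2 + A ^ 2 ≤
      (3 + 2 * M ^ 2) * (1 + 1 / c ^ 2) * ((t - z.re) ^ 2 + z.im ^ 2) := by
    refine h2.trans ((mul_le_mul_of_nonneg_left h1 (by positivity)).trans_eq (by ring))
  unfold poissonKernel
  rw [← mul_div_assoc, div_le_div_iff₀ hd (by positivity)]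
  calc _ ≤ _ := mul_le_mul_of_nonneg_left h3 (by positivity : 0 ≤ 1 + t ^ 2)
    _ = _ := by ring

lemma radial_le_poissonKernel {z : ℂ} (hz : 0 < z.im) {M A c : ℝ} (hA : 0 < A)
    (hM : |z.re| ≤ M * z.im) (hAz : z.im ≤ A * c) (t : ℝ) :
    (1 + t ^ 2) / (t ^ 2 + A ^ 2) ≤
      ((2 + 2 * M ^ 2) * (1 + c ^ 2)) * poissonKernel z t := by
  have hd := poissonKernel_denom_pos hz t
  have hx : z.re ^ 2 ≤ M ^ 2 * z.im ^ 2 := by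
    rw [← mul_pow, ← sq_abs]
    exact pow_le_pow_left₀ (abs_nonneg _) hM 2
  have hA2 : z.im ^ 2 ≤ c ^ 2 * A ^ 2 := by
    rw [← mul_pow, mul_comm c]
    exact pow_le_pow_left₀ hz.le hAz 2
  have h1 : (t - z.re) ^ 2 + z.im ^ 2 ≤ (2 + 2 * M ^ 2) * (t ^ 2 + z.im ^ 2) := by
    nlinarith [sq_nonneg (t + z.re), mul_nonneg (sq_nonneg M) (sq_nonneg t), sq_nonneg z.im]
  have h2 : t ^ 2 + z.im ^ 2 ≤ (1 + c ^ 2) * (t ^ 2 + A ^ 2) := by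
    nlinarith [mul_nonneg (sq_nonneg c) (sq_nonneg t), sq_nonneg A]
  have h3 : (t - z.re) ^ 2 + z.im ^ 2 ≤ (2 + 2 * M ^ 2) * (1 + c ^ 2) * (t ^ 2 + A ^ 2) := by
    refine h1.trans ((mul_le_mul_of_nonneg_left h2 (by positivity)).trans_eq (by ring))
  unfold poissonKernel
  rw [← mul_div_assoc, div_le_div_iff₀ (by positivity) hd]
  calc _ ≤ _ := mul_le_mul_of_nonneg_left h3 (by positivity : 0 ≤ 1 + t ^ 2)
    _ = _ := by ring

end Comparison

/-! ### Orbit growth against radial masses. -/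

section Growth

variable {f : UpperHalfPlane → UpperHalfPlane} {α β : ℝ} {μ : Measure ℝ} [IsFiniteMeasure μ]

/-- Uses `log x ≤ x - 1` termwise; the height at time `k` is at least `αᵏ Im z`, so the Poisson
integral is controlled by the `k`-th radial mass. -/
lemma IsRepresentedBy.exists_log_im_le (hrep : IsRepresentedBy f α β μ) (hα : 1 < α)
    {z : UpperHalfPlane} {M : ℝ} (hM : ∀ n : ℕ, |(f^[n] z).re| ≤ M * (f^[n] z).im) :
    ∃ C : ℝ, 0 < C ∧ ∀ n : ℕ, Real.log ((f^[n] z).im / (α ^ n * z.im)) ≤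
      C * ∑ k ∈ Finset.range n, radialMass α μ k := by
  have h0 : 0 < α := one_pos.trans hα
  have hz := z.im_pos
  refine ⟨((3 + 2 * M ^ 2) * (1 + 1 / z.im ^ 2)) / α, by positivity, fun n => ?_⟩
  rw [hrep.log_im_iterate h0, Finset.mul_sum]
  refine Finset.sum_le_sum fun k _ => ?_
  have q := (f^[k] z).im_pos
  have a2 := h0.trans_le (le_imFactor α μ q)
  refine (Real.log_le_sub_one_of_pos (by positivity)).trans ?_
  have e : imFactor α μ (f^[k] z) / α - 1 = (∫ t, poissonKernel (f^[k] z) t ∂μ) / α := by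
    unfold imFactor
    field_simp
    ring
  rw [e, div_mul_eq_mul_div]
  refine div_le_div_of_nonneg_right ?_ h0.le
  unfold radialMass
  rw [← integral_const_mul]
  refine integral_mono (integrable_poissonKernel μ q)
    ((integrable_radial h0 μ k).const_mul _) fun t => ?_
  have := poissonKernel_le_radial q (pow_pos h0 k) hz (hM k) (hrep.pow_mul_im_le z k) t
  rwa [← pow_mul, mul_comm k 2] at this

/-- The height is only known to grow at most like `Kᵏ`, possibly faster than `αᵏ`. With `K ≤ αᵐ` the
comparison is made at index `m k`, and monotonicity of the masses recovers the full sum at the cost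
of a factor `m`. -/
lemma IsRepresentedBy.exists_le_log_im (hrep : IsRepresentedBy f α β μ) (hα : 1 < α)
    {z : UpperHalfPlane} {M K : ℝ} (hK : 1 ≤ K)
    (hM : ∀ n : ℕ, |(f^[n] z).re| ≤ M * (f^[n] z).im)
    (hKim : ∀ n : ℕ, (f^[n + 1] z).im ≤ K * (f^[n] z).im) :
    ∃ c : ℝ, 0 < c ∧ ∀ n : ℕ, c * ∑ k ∈ Finset.range n, radialMass α μ k ≤
      Real.log ((f^[n] z).im / (α ^ n * z.im)) := by
  have h0 : 0 < α := one_pos.trans hα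
  have hK0 : 0 < K := one_pos.trans_le hK
  have hz := z.im_pos
  obtain ⟨m, hm, hKm⟩ : ∃ m : ℕ, 1 ≤ m ∧ K ≤ α ^ m := by
    obtain ⟨m, hm⟩ := pow_unbounded_of_one_lt K hα
    exact ⟨m + 1, by omega, hm.le.trans (pow_le_pow_right₀ hα.le (by omega))⟩
  have him : ∀ k : ℕ, (f^[k] z).im ≤ α ^ (m * k) * z.im := fun k => by
    induction k with
    | zero => simp
    | succ k ih =>
      refine (hKim k).trans ((mul_le_mul hKm ih (f^[k] z).im_pos.le (by positivity)).trans_eq ?_)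
      ring
  obtain ⟨B, hB⟩ : ∃ B, B = (2 + 2 * M ^ 2) * (1 + z.im ^ 2) := ⟨_, rfl⟩
  have hB0 : 0 < B := hB ▸ by positivity
  have hterm : ∀ k : ℕ, (B * K)⁻¹ * radialMass α μ (m * k) ≤
      Real.log (imFactor α μ (f^[k] z) / α) := fun k => by
    have q := (f^[k] z).im_pos
    have a1 := le_imFactor α μ q
    have a2 := h0.trans_le a1
    have hKf : imFactor α μ (f^[k] z) ≤ K := by
      have := hKim k
      rw [hrep.im_iterate_succ, mul_comm K] at this
      exact le_of_mul_le_mul_left this q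
    have hmass : radialMass α μ (m * k) ≤ B * ∫ t, poissonKernel (f^[k] z) t ∂μ := by
      unfold radialMass
      rw [← integral_const_mul]
      refine integral_mono (integrable_radial h0 μ (m * k))
        ((integrable_poissonKernel μ q).const_mul _) fun t => ?_
      have := radial_le_poissonKernel q (pow_pos h0 (m * k)) (hM k) (him k) t
      rwa [← pow_mul, mul_comm (m * k) 2, ← hB] at this
    refine le_trans ?_ (Real.one_sub_inv_le_log_of_pos (by positivity))
    have e : 1 - (imFactor α μ (f^[k] z) / α)⁻¹ =
        (∫ t, poissonKernel (f^[k] z) t ∂μ) / imFactor α μ (f^[k] z) := by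
      rw [inv_div, eq_div_iff a2.ne', sub_mul, div_mul_cancel₀ _ a2.ne']
      unfold imFactor
      ring
    rw [e]
    have hP := integral_poissonKernel_nonneg μ q
    calc _ ≤ (B * K)⁻¹ * (B * ∫ t, poissonKernel (f^[k] z) t ∂μ) := by gcongr
      _ = (∫ t, poissonKernel (f^[k] z) t ∂μ) / K := by field_simp
      _ ≤ _ := div_le_div_of_nonneg_left hP a2 hKf
  have hm0 : (0 : ℝ) < m := by exact_mod_cast hm
  refine ⟨(B * K)⁻¹ / m, by positivity, fun n => ?_⟩
  rw [hrep.log_im_iterate h0]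
  calc _ ≤ (B * K)⁻¹ / m * (m * ∑ k ∈ Finset.range n, radialMass α μ (m * k)) := by
        refine mul_le_mul_of_nonneg_left ?_ (by positivity)
        exact sum_range_le_mul_sum_of_antitone (radialMass_antitone hα μ)
          (radialMass_nonneg h0 μ) hm n
    _ = ∑ k ∈ Finset.range n, (B * K)⁻¹ * radialMass α μ (m * k) := by
        rw [← Finset.mul_sum]
        field_simp
    _ ≤ _ := Finset.sum_le_sum fun k _ => hterm k

/-- The logarithm of the normalised orbit is comparable to the partial sums of the radial
masses. -/
lemma IsRepresentedBy.exists_log_norm_bounds (hrep : IsRepresentedBy f α β μ) (hα : 1 < α)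
    (hμ : μ ≠ 0) (z : UpperHalfPlane) : ∃ c C : ℝ, 0 < c ∧ 0 < C ∧ ∀ n : ℕ, 1 ≤ n →
      c * ∑ k ∈ Finset.range n, radialMass α μ k ≤
          Real.log (‖(f^[n + 1] z : ℂ)‖ / (α ^ (n + 1) * z.im)) ∧
        Real.log (‖(f^[n + 1] z : ℂ)‖ / (α ^ (n + 1) * z.im)) ≤
          C * ∑ k ∈ Finset.range n, radialMass α μ k := by
  have h0 : 0 < α := one_pos.trans hα
  have hz := z.im_pos
  obtain ⟨M, K, hM0, hK, hMK⟩ := hrep.exists_sector hα z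
  obtain ⟨C, hC, hupper⟩ := hrep.exists_log_im_le hα fun n => (hMK n).1
  obtain ⟨c, hc, hlower⟩ := hrep.exists_le_log_im hα hK (fun n => (hMK n).1) fun n => (hMK n).2
  have hJ0 := radialMass_zero_pos α hμ
  have hJ := radialMass_nonneg h0 μ
  have hlogM : 0 ≤ Real.log (M + 1) := Real.log_nonneg (by linarith)
  -- The sum for `f^[n + 1]` has one term more than `T`; that term is at most `T`, hence `2 * C`.
  -- The sector loss `log (M + 1)` is absorbed using `radialMass α μ 0 ≤ T`, which needs `n ≥ 1`.
  refine ⟨c, 2 * C + Real.log (M + 1) / radialMass α μ 0, hc, by positivity, fun n hn => ?_⟩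
  have q := (f^[n + 1] z).im_pos
  have him : (f^[n + 1] z).im ≤ ‖(f^[n + 1] z : ℂ)‖ := by
    have := Complex.abs_im_le_norm (f^[n + 1] z : ℂ)
    rwa [UpperHalfPlane.coe_im, abs_of_pos q] at this
  have hnorm : ‖(f^[n + 1] z : ℂ)‖ ≤ (M + 1) * (f^[n + 1] z).im := by
    have h1 := Complex.norm_le_abs_re_add_abs_im (f^[n + 1] z : ℂ)
    rw [UpperHalfPlane.coe_im, UpperHalfPlane.coe_re, abs_of_pos q] at h1
    linarith [(hMK (n + 1)).1]
  have hT0 : radialMass α μ 0 ≤ ∑ k ∈ Finset.range n, radialMass α μ k :=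
    Finset.single_le_sum (fun k _ => hJ k) (Finset.mem_range.mpr hn)
  have hTn : radialMass α μ n ≤ ∑ k ∈ Finset.range n, radialMass α μ k :=
    (radialMass_antitone hα μ (Nat.zero_le n)).trans hT0
  have hu := hupper (n + 1)
  have hl := hlower (n + 1)
  rw [Finset.sum_range_succ] at hu hl
  have hJn := hJ n
  generalize ∑ k ∈ Finset.range n, radialMass α μ k = T at *
  have hd : 0 < α ^ (n + 1) * z.im := by positivity
  constructor
  · calc c * T ≤ c * (T + radialMass α μ n) := by gcongr; linarith
      _ ≤ _ := hl
      _ ≤ _ := Real.log_le_log (by positivity) (by gcongr)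
  · calc _ ≤ Real.log ((M + 1) * ((f^[n + 1] z).im / (α ^ (n + 1) * z.im))) := by
          refine Real.log_le_log (div_pos (q.trans_le him) hd) ?_
          rw [← mul_div_assoc]
          gcongr
      _ = Real.log (M + 1) + Real.log ((f^[n + 1] z).im / (α ^ (n + 1) * z.im)) :=
          Real.log_mul (by positivity) (by positivity)
      _ ≤ Real.log (M + 1) / radialMass α μ 0 * T + C * (T + T) := by
          refine add_le_add ?_ (hu.trans (by gcongr))
          rw [div_mul_eq_mul_div, le_div_iff₀ hJ0]
          gcongr
      _ = _ := by ring

end Growth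

/-! ### Removing the normalisation by `Im z`, and the theorem. -/

/-- If `L` is comparable to `I`, then `L + b` stays comparable to `I` as long as it is bounded
below by a positive constant. -/
lemma exists_lower_bound_of_shift {ι : Type*} {p : ι → Prop} {L I : ι → ℝ} {c b ε : ℝ} (hc : 0 < c)
    (hε : 0 < ε) (hL : ∀ i, p i → c * I i ≤ L i)
    (hLb : ∀ i, p i → ε ≤ L i + b) : ∃ c' : ℝ, 0 < c' ∧ ∀ i, p i → c' * I i ≤ L i + b := by
  have hb : 0 ≤ |b| := abs_nonneg b
  have hs : 0 < |b| + ε := by positivity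
  -- Add `|b|` times `ε ≤ L + b` to `ε` times `c I - |b| ≤ L + b`; the terms `ε |b|` cancel.
  refine ⟨ε / (|b| + ε) * c, by positivity, fun i hi => ?_⟩
  rw [mul_assoc, div_mul_eq_mul_div, div_le_iff₀ hs]
  have h1 := hL i hi
  have h2 := hLb i hi
  have h3 := neg_abs_le b
  nlinarith [mul_le_mul_of_nonneg_left h2 hb, mul_le_mul_of_nonneg_left h1 hε.le]

end HalfPlaneDynamics

theorem proposition4p5 (f : UpperHalfPlane → UpperHalfPlane) (α β : ℝ)
    (μ : MeasureTheory.Measure ℝ) [MeasureTheory.IsFiniteMeasure μ]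
    (hf : HalfPlaneDynamics.IsHyperbolicAtInfty f)
    (hrep : HalfPlaneDynamics.IsRepresentedBy f α β μ)
    (hμ : μ ≠ 0) (z : UpperHalfPlane) :
    (∃ C₁ C₂ : ℝ, 0 < C₁ ∧ 0 < C₂ ∧ ∀ n : ℕ, 1 ≤ n →
      C₁ ≤ Real.log (‖((f^[n + 1] z : UpperHalfPlane) : ℂ)‖ / (α ^ (n + 1) * z.im)) /
          HalfPlaneDynamics.divergenceIntegral α μ n ∧
      Real.log (‖((f^[n + 1] z : UpperHalfPlane) : ℂ)‖ / (α ^ (n + 1) * z.im)) /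
          HalfPlaneDynamics.divergenceIntegral α μ n ≤ C₂) ∧
    ((∃ C₁ C₂ : ℝ, 0 < C₁ ∧ 0 < C₂ ∧ ∀ n : ℕ, 1 ≤ n →
      C₁ ≤ Real.log (‖((f^[n + 1] z : UpperHalfPlane) : ℂ)‖ / α ^ (n + 1)) /
          HalfPlaneDynamics.divergenceIntegral α μ n ∧
      Real.log (‖((f^[n + 1] z : UpperHalfPlane) : ℂ)‖ / α ^ (n + 1)) /
          HalfPlaneDynamics.divergenceIntegral α μ n ≤ C₂) ↔
      ∃ δ : ℝ, 1 < δ ∧ ∀ n : ℕ, 1 ≤ n →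
        δ ≤ ‖((f^[n + 1] z : UpperHalfPlane) : ℂ)‖ / α ^ (n + 1)) := by
  obtain ⟨a, ha1, ha⟩ := hf.one_lt_angularDeriv
  have hα : 1 < α := hrep.angularDeriv_eq ha ▸ ha1
  have h0 : 0 < α := one_pos.trans hα
  have h1 : 0 < α ^ 2 - 1 := by nlinarith
  have hz := z.im_pos
  obtain ⟨c, C, hc, hC, hbd⟩ := hrep.exists_log_norm_bounds hα hμ z
  have hJ0 := HalfPlaneDynamics.radialMass_zero_pos α hμ
  have hI := HalfPlaneDynamics.divergenceIntegral_bounds hα μ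
  obtain ⟨κ, hκ, hIκ⟩ : ∃ κ : ℝ, 0 < κ ∧ ∀ n : ℕ, 1 ≤ n →
      κ ≤ HalfPlaneDynamics.divergenceIntegral α μ n := by
    -- The `k = 0` term alone bounds every `I_n` from below.
    refine ⟨(α ^ 2 - 1) / α ^ 2 * HalfPlaneDynamics.radialMass α μ 0, by positivity,
      fun n hn => le_trans ?_ (hI n).1⟩
    gcongr
    exact Finset.single_le_sum (f := HalfPlaneDynamics.radialMass α μ)
      (fun k _ => HalfPlaneDynamics.radialMass_nonneg h0 μ k) (Finset.mem_range.mpr hn)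
  have hIpos : ∀ n : ℕ, 1 ≤ n → 0 < HalfPlaneDynamics.divergenceIntegral α μ n :=
    fun n hn => hκ.trans_le (hIκ n hn)
  have hlow : ∀ n : ℕ, 1 ≤ n → c / (α ^ 2 - 1) * HalfPlaneDynamics.divergenceIntegral α μ n ≤
      Real.log (‖((f^[n + 1] z : UpperHalfPlane) : ℂ)‖ / (α ^ (n + 1) * z.im)) := fun n hn => by
    refine le_trans ?_ (hbd n hn).1
    rw [div_mul_eq_mul_div, div_le_iff₀ h1]
    calc _ ≤ _ := mul_le_mul_of_nonneg_left (hI n).2 hc.le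
      _ = _ := by ring
  have hupp : ∀ n : ℕ, 1 ≤ n →
      Real.log (‖((f^[n + 1] z : UpperHalfPlane) : ℂ)‖ / (α ^ (n + 1) * z.im)) ≤
        C * α ^ 2 / (α ^ 2 - 1) * HalfPlaneDynamics.divergenceIntegral α μ n := fun n hn => by
    refine (hbd n hn).2.trans ?_
    rw [div_mul_eq_mul_div, le_div_iff₀ h1]
    calc _ = C * α ^ 2 * ((α ^ 2 - 1) / α ^ 2 *
          ∑ k ∈ Finset.range n, HalfPlaneDynamics.radialMass α μ k) := by field_simp
      _ ≤ _ := mul_le_mul_of_nonneg_left (hI n).1 (by positivity)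
  have hnpos : ∀ n : ℕ, 0 < ‖((f^[n] z : UpperHalfPlane) : ℂ)‖ :=
    fun n => norm_pos_iff.mpr (f^[n] z).ne_zero
  have hshift : ∀ n : ℕ, Real.log (‖((f^[n + 1] z : UpperHalfPlane) : ℂ)‖ / α ^ (n + 1)) =
      Real.log (‖((f^[n + 1] z : UpperHalfPlane) : ℂ)‖ / (α ^ (n + 1) * z.im)) +
        Real.log z.im := fun n => by
    have := hnpos (n + 1)
    rw [← Real.log_mul (by positivity) (by positivity)]
    congr 1
    field_simp
  refine ⟨⟨c / (α ^ 2 - 1), C * α ^ 2 / (α ^ 2 - 1), by positivity, by positivity, fun n hn =>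
    ⟨(le_div_iff₀ (hIpos n hn)).mpr (hlow n hn), (div_le_iff₀ (hIpos n hn)).mpr (hupp n hn)⟩⟩,
    ?_, ?_⟩
  · rintro ⟨C₁, C₂, hC₁, -, h⟩
    refine ⟨Real.exp (C₁ * κ), Real.one_lt_exp_iff.mpr (by positivity), fun n hn => ?_⟩
    have hp : 0 < ‖((f^[n + 1] z : UpperHalfPlane) : ℂ)‖ / α ^ (n + 1) :=
      div_pos (hnpos _) (by positivity)
    rw [← Real.le_log_iff_exp_le hp]
    have := (le_div_iff₀ (hIpos n hn)).mp (h n hn).1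
    exact (mul_le_mul_of_nonneg_left (hIκ n hn) hC₁.le).trans this
  · rintro ⟨δ, hδ, h⟩
    obtain ⟨c', hc', hlow'⟩ := HalfPlaneDynamics.exists_lower_bound_of_shift
      (p := fun n : ℕ => 1 ≤ n) (b := Real.log z.im) (ε := Real.log δ)
      (show 0 < c / (α ^ 2 - 1) by positivity) (Real.log_pos hδ) hlow
      fun n hn => hshift n ▸ Real.log_le_log (one_pos.trans hδ) (h n hn)
    -- The extra summand absorbs the shift, since `|log (Im z)| ≤ (|log (Im z)| / κ) I_n`.
    refine ⟨c', C * α ^ 2 / (α ^ 2 - 1) + |Real.log z.im| / κ, hc', by positivity, fun n hn =>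
      ⟨(le_div_iff₀ (hIpos n hn)).mpr (hshift n ▸ hlow' n hn),
        (div_le_iff₀ (hIpos n hn)).mpr ?_⟩⟩
    rw [hshift, add_mul]
    refine add_le_add (hupp n hn) ((le_abs_self _).trans ?_)
    rw [div_mul_eq_mul_div, le_div_iff₀ hκ]
    exact mul_le_mul_of_nonneg_left (hIκ n hn) (abs_nonneg _)
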